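/- Let $0<\alpha<2$, and let $S_\alpha(\sigma,0,0)$ denote the symmetric $\alpha$-stable law on $\mathbb{R}$ with characteristic function $u\mapsto e^{-\sigma^\alpha|u|^\alpha}$. Let $M$ be a symmetric $\alpha$-stable random measure on $\mathbb{R}$ with control measure Lebesgue measure $\mathcal{L}$, that is, a random set function on the Borel sets of finite Lebesgue measure which takes independent values on disjoint sets, is almost surely $\sigma$-additive, and satisfies $M(A)\sim S_\alpha(\mathcal{L}(A)^{1/\alpha},0,0)$. Let $g:\mathbb{R}\to\mathbb{R}$ be measurable with $\int|g(x)|^\alpha\,dx<\infty$, and let $$Y(t)=\int g(t-x)\,M(dx)\qquad(t\in\mathbb{R})$$ be the corresponding moving average process, where $\int f\,dM$ is the limit in probability of the integrals of simple functions, with supports of finite measure, converging to $f$ in $L^\alpha(\mathbb{R})$. Suppose that there are constants $c>0$ and $\lambda>1$ such that, for all sufficiently small $|h|$, $$\int|g(h-x)-g(-x)|^\alpha\,dx\le c\,|h|^\lambda .$$ Then $Y$ has a continuous version $Z$ (that is, $P(Z(t)=Y(t))=1$ for every $t\in\mathbb{R}$, and every path of $Z$ is continuous) such that, for every $0\le\theta<(\lambda-1)/\alpha$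 and every bounded interval $[a,b]$, each path of $Z$ satisfies a $\theta$-Hölder condition on $[a,b]$: $|Z(t)-Z(s)|\le C|t-s|^\theta$ for all $s,t\in[a,b]$, where the finite constant $C$ may depend on the path, on $\theta$ and on $[a,b]$. -/

import Mathlib

open MeasureTheory ProbabilityTheory Filter Topology
open scoped ENNReal NNReal

/-- `μ` is the symmetric `α`-stable law `S_α(σ, 0, 0)` with scale `σ`, given by its
characteristic function `u ↦ exp (-σ ^ α |u| ^ α)`. -/
def IsSymStableLaw (α σ : ℝ) (μ : Measure ℝ) : Prop :=
  ∀ u : ℝ, charFun μ u = ((Real.exp (-(σ ^ α * |u| ^ α)) : ℝ) : ℂ)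

/-- `M` is a symmetric `α`-stable random measure on `E` with control measure `m`: a random set
function on the measurable sets of finite `m`-measure (its values on other sets are irrelevant)
which is independently scattered, almost surely `σ`-additive, and such that
`M A` has law `S_α(m(A) ^ (1 / α), 0, 0)`.
The series `∑ M (A i)` is the limit of its partial sums; it need not converge absolutely. -/
structure IsSymStableRandomMeasure {E Ω : Type*} [MeasurableSpace E] [MeasurableSpace Ω]
    (α : ℝ) (m : Measure E) (P : Measure Ω) (M : Set E → Ω → ℝ) : Prop where
  measurable : ∀ A : Set E, MeasurableSet A → m A < ∞ → Measurable (M A)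
  law : ∀ A : Set E, MeasurableSet A → m A < ∞ →
    IsSymStableLaw α ((m A).toReal ^ (1 / α)) (P.map (M A))
  indep : ∀ (n : ℕ) (A : Fin n → Set E), (∀ i, MeasurableSet (A i)) → (∀ i, m (A i) < ∞) →
    (∀ i j, i ≠ j → Disjoint (A i) (A j)) → iIndepFun (fun i => M (A i)) P
  sigma_additive : ∀ A : ℕ → Set E, (∀ i, MeasurableSet (A i)) → m (⋃ i, A i) < ∞ →
    (∀ i j, i ≠ j → Disjoint (A i) (A j)) →
    ∀ᵐ ω ∂P, Tendsto (fun n => ∑ i ∈ Finset.range n, M (A i) ω) atTop (𝓝 (M (⋃ i, A i) ω))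

/-- The integral `∑ c · M {f = c}` of a simple function; the value `c = 0` contributes nothing,
so only sets of finite measure matter when `f` has a support of finite measure. -/
noncomputable def simpleStableIntegral {E Ω : Type*} [MeasurableSpace E]
    (M : Set E → Ω → ℝ) (f : SimpleFunc E ℝ) (ω : Ω) : ℝ :=
  ∑ c ∈ f.range, c * M (f ⁻¹' {c}) ω

/-- The random variable `X` is (a version of) the stochastic integral `∫ f dM`: the limit in
probability of the integrals of simple functions, with supports of finite measure, that converge
to `f` in the `L^α` (quasi-)norm. -/
def IsStableIntegral {E Ω : Type*} [MeasurableSpace E] [MeasurableSpace Ω]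
    (α : ℝ) (m : Measure E) (P : Measure Ω) (M : Set E → Ω → ℝ) (f : E → ℝ) (X : Ω → ℝ) : Prop :=
  Measurable X ∧
    ∃ F : ℕ → SimpleFunc E ℝ, (∀ n, (F n).FinMeasSupp m) ∧
      Tendsto (fun n => eLpNorm (fun x => F n x - f x) (ENNReal.ofReal α) m) atTop (𝓝 0) ∧
      TendstoInMeasure P (fun n => simpleStableIntegral M (F n)) atTop X

/-- `Y` is the moving average process `Y(t) = ∫ g(t - x) M(dx)`, `t ∈ ℝ`, the control measure of
`M` being Lebesgue measure. -/
def IsStableMovingAverage {Ω : Type*} [MeasurableSpace Ω]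
    (α : ℝ) (P : Measure Ω) (M : Set ℝ → Ω → ℝ) (g : ℝ → ℝ) (Y : ℝ → Ω → ℝ) : Prop :=
  ∀ t : ℝ, IsStableIntegral α volume P M (fun x => g (t - x)) (Y t)

/-!
By linearity and passage to the limit, `∫ f dM` has law `S_α(‖f‖_α, 0, 0)`, so its characteristic
function gives `P(|Y(t) - Y(s)| > r) ≤ C |t - s| ^ λ r ^ (-α)` for `t` close to `s`. Kolmogorov's
chaining argument is run directly on these tails, a stable variable having no moment of order `α`:
at dyadic level `n` there are about `2 ^ n` steps, and some increment exceeds `2 ^ (-θ n)` with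
probability of order `2 ^ (-(λ - 1 - θ α) n)`. This is summable when `θ < (λ - 1) / α`, and
Borel–Cantelli followed by geometric summation over the levels yields the Hölder condition.
-/

namespace IsSymStableLaw

variable {Ω : Type*} [MeasurableSpace Ω] {P : Measure Ω} {α σ : ℝ}

lemma map_const_mul {X : Ω → ℝ} (hX : IsSymStableLaw α σ (P.map X)) (hXm : AEMeasurable X P)
    (hσ : 0 ≤ σ) (c : ℝ) : IsSymStableLaw α (|c| * σ) (P.map fun ω => c * X ω) := by
  intro u
  rw [charFun_map_mul_comp hXm, hX, abs_mul, Real.mul_rpow (abs_nonneg c) (abs_nonneg u),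
    Real.mul_rpow (abs_nonneg c) hσ]
  congr 3
  ring

lemma map_sum {ι : Type*} [Fintype ι] {X : ι → Ω → ℝ} {σ : ι → ℝ}
    (hX : ∀ i, IsSymStableLaw α (σ i) (P.map (X i))) (hXm : ∀ i, AEMeasurable (X i) P)
    (hind : iIndepFun X P) (hα : α ≠ 0) (hσ : ∀ i, 0 ≤ σ i) :
    IsSymStableLaw α ((∑ i, σ i ^ α) ^ (1 / α)) (P.map fun ω => ∑ i, X i ω) := by
  intro u
  have hsum : 0 ≤ ∑ i, σ i ^ α := Finset.sum_nonneg fun i _ => Real.rpow_nonneg (hσ i) α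
  rw [congrFun (hind.charFun_map_fun_sum_eq_prod hXm) u, Finset.prod_apply, one_div,
    Real.rpow_inv_rpow hsum hα, Finset.sum_mul, ← Finset.sum_neg_distrib, Real.exp_sum,
    Complex.ofReal_prod]
  exact Finset.prod_congr rfl fun i _ => hX i u

lemma of_tendstoInMeasure [IsProbabilityMeasure P] {X : ℕ → Ω → ℝ} {Y : Ω → ℝ} {σ : ℕ → ℝ}
    {τ : ℝ} (hX : ∀ n, IsSymStableLaw α (σ n) (P.map (X n))) (hXm : ∀ n, AEMeasurable (X n) P)
    (hα : 0 < α) (hXY : TendstoInMeasure P X atTop Y) (hσ : Tendsto σ atTop (𝓝 τ)) :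
    IsSymStableLaw α τ (P.map Y) := by
  intro u
  have hlaw := (hXY.tendstoInDistribution hXm).tendsto
  have hchar := ProbabilityMeasure.tendsto_iff_tendsto_charFun.1 hlaw u
  refine tendsto_nhds_unique hchar ?_
  simp only [ProbabilityMeasure.coe_mk, fun n => hX n u]
  have hexp : Continuous fun s : ℝ => ((Real.exp (-(s ^ α * |u| ^ α)) : ℝ) : ℂ) := by
    have := Real.continuous_rpow_const hα.le
    fun_prop
  exact (hexp.tendsto τ).comp hσ

lemma measureReal_abs_gt_le {μ : Measure ℝ} [IsProbabilityMeasure μ] (hμ : IsSymStableLaw α σ μ)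
    (hα : 0 ≤ α) (hσ : 0 ≤ σ) {r : ℝ} (hr : 0 < r) :
    μ.real {x | r < |x|} ≤ 2 * (2 * σ / r) ^ α := by
  have hchar : ∀ u ∈ Set.uIoc (-2 * r⁻¹) (2 * r⁻¹), ‖1 - charFun μ u‖ ≤ (2 * σ / r) ^ α := by
    intro u hu
    have hr' : 0 < r⁻¹ := inv_pos.2 hr
    rw [Set.uIoc_of_le (by linarith)] at hu
    have hexp := Real.add_one_le_exp (-(σ ^ α * |u| ^ α))
    have hexp' : Real.exp (-(σ ^ α * |u| ^ α)) ≤ 1 :=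
      Real.exp_le_one_iff.2 (neg_nonpos.2 (by positivity))
    calc ‖1 - charFun μ u‖ = 1 - Real.exp (-(σ ^ α * |u| ^ α)) := by
          rw [hμ, ← Complex.ofReal_one, ← Complex.ofReal_sub, Complex.norm_real,
            Real.norm_of_nonneg (by linarith)]
      _ ≤ σ ^ α * |u| ^ α := by linarith
      _ ≤ σ ^ α * (2 * r⁻¹) ^ α := by
          gcongr
          exact abs_le.2 ⟨by linarith [hu.1], hu.2⟩
      _ = (2 * σ / r) ^ α := by
          rw [← Real.mul_rpow hσ (by positivity)]
          ring_nf
  calc μ.real {x | r < |x|}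
      ≤ 2⁻¹ * r * ‖∫ u in (-2 * r⁻¹)..(2 * r⁻¹), 1 - charFun μ u‖ :=
        measureReal_abs_gt_le_integral_charFun hr
    _ ≤ 2⁻¹ * r * ((2 * σ / r) ^ α * |2 * r⁻¹ - -2 * r⁻¹|) := by
        gcongr
        exact intervalIntegral.norm_integral_le_of_norm_le_const hchar
    _ = 2 * (2 * σ / r) ^ α := by
        rw [show 2 * r⁻¹ - -2 * r⁻¹ = 4 * r⁻¹ by ring, abs_of_pos (by positivity)]
        field_simp
        ring

end IsSymStableLaw

namespace IsSymStableRandomMeasure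

variable {E Ω : Type*} [MeasurableSpace E] [MeasurableSpace Ω] {α : ℝ} {m : Measure E}
  {P : Measure Ω} {M : Set E → Ω → ℝ}

lemma ae_empty (hM : IsSymStableRandomMeasure α m P M) : M ∅ =ᵐ[P] 0 := by
  filter_upwards [hM.sigma_additive (fun _ => ∅) (by simp) (by simp) (by simp)] with ω hω
  simp only [Set.iUnion_empty, Finset.sum_const, Finset.card_range] at hω
  have hsucc := (tendsto_add_atTop_iff_nat 1).2 hω
  simp only [succ_nsmul] at hsucc
  simpa using tendsto_nhds_unique hsucc (hω.add_const (M ∅ ω))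

lemma ae_union (hM : IsSymStableRandomMeasure α m P M) {A B : Set E} (hA : MeasurableSet A)
    (hB : MeasurableSet B) (hmA : m A < ∞) (hmB : m B < ∞) (hAB : Disjoint A B) :
    M (A ∪ B) =ᵐ[P] M A + M B := by
  let C : ℕ → Set E
    | 0 => A
    | 1 => B
    | _ => ∅
  have hC : ⋃ i, C i = A ∪ B := by
    rw [← Set.iSup_eq_iUnion, ← sup_iSup_nat_succ C, ← sup_iSup_nat_succ fun i => C (i + 1)]
    simp [C]
  have hlim := hM.sigma_additive C
    (by rintro (_ | _ | i) <;> simp [C, hA, hB])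
    (hC ▸ measure_union_lt_top hmA hmB)
    (by rintro (_ | _ | i) (_ | _ | j) hij <;> simp_all [C, disjoint_comm])
  filter_upwards [hlim, hM.ae_empty] with ω hω hempty
  rw [hC, ← tendsto_add_atTop_iff_nat 2] at hω
  simp only [Finset.sum_range_succ', C, hempty, Pi.zero_apply, Finset.sum_const_zero, zero_add]
    at hω
  rw [Pi.add_apply, add_comm]
  exact tendsto_nhds_unique hω tendsto_const_nhds

lemma ae_biUnion_finset (hM : IsSymStableRandomMeasure α m P M) {ι : Type*} (s : Finset ι)
    (A : ι → Set E) (hA : ∀ i ∈ s, MeasurableSet (A i)) (hm : ∀ i ∈ s, m (A i) < ∞)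
    (hd : (s : Set ι).PairwiseDisjoint A) :
    ∀ᵐ ω ∂P, M (⋃ i ∈ s, A i) ω = ∑ i ∈ s, M (A i) ω := by
  classical
  induction s using Finset.induction_on with
  | empty => simpa [EventuallyEq] using hM.ae_empty
  | insert a s ha ih =>
    have hA' : ∀ i ∈ s, MeasurableSet (A i) := fun i hi => hA i (Finset.mem_insert_of_mem hi)
    have hm' : ∀ i ∈ s, m (A i) < ∞ := fun i hi => hm i (Finset.mem_insert_of_mem hi)
    have hdisj : Disjoint (A a) (⋃ i ∈ s, A i) := Set.disjoint_iUnion₂_right.2 fun i hi =>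
      hd (by simp) (by simp [hi]) (ne_of_mem_of_not_mem hi ha).symm
    have hunion := hM.ae_union (hA a (by simp)) (Finset.measurableSet_biUnion s hA')
      (hm a (by simp)) (measure_biUnion_lt_top s.finite_toSet hm') hdisj
    filter_upwards [ih hA' hm' (hd.subset (by simp)), hunion] with ω hs hins
    rw [Finset.set_biUnion_insert, hins, Pi.add_apply, hs, Finset.sum_insert ha]

lemma iIndepFun_of_disjoint (hM : IsSymStableRandomMeasure α m P M) {ι : Type*} [Finite ι]
    {A : ι → Set E} (hA : ∀ i, MeasurableSet (A i)) (hm : ∀ i, m (A i) < ∞)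
    (hd : Pairwise fun i j => Disjoint (A i) (A j)) : iIndepFun (fun i => M (A i)) P := by
  obtain ⟨n, ⟨e⟩⟩ := Finite.exists_equiv_fin ι
  have hfin := hM.indep n (fun k => A (e.symm k)) (fun k => hA _) (fun k => hm _)
    (fun i j hij => hd (e.symm.injective.ne hij))
  simpa using hfin.precomp e.injective

lemma isSymStableLaw_sum (hM : IsSymStableRandomMeasure α m P M) (hα : α ≠ 0) {ι : Type*}
    [Fintype ι] {A : ι → Set E} (hA : ∀ i, MeasurableSet (A i)) (hm : ∀ i, m (A i) < ∞)
    (hd : Pairwise fun i j => Disjoint (A i) (A j)) (c : ι → ℝ) :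
    IsSymStableLaw α ((∑ i, |c i| ^ α * (m (A i)).toReal) ^ (1 / α))
      (P.map fun ω => ∑ i, c i * M (A i) ω) := by
  have hmeas : ∀ i, Measurable (M (A i)) := fun i => hM.measurable _ (hA i) (hm i)
  have hσ : ∀ i, 0 ≤ (m (A i)).toReal ^ (1 / α) := fun i => by positivity
  have hind := (hM.iIndepFun_of_disjoint hA hm hd).comp (fun i x => c i * x)
    (fun i => measurable_const_mul (c i))
  have hlaw := IsSymStableLaw.map_sum (α := α)
    (fun i => (hM.law _ (hA i) (hm i)).map_const_mul (hmeas i).aemeasurable (hσ i) (c i))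
    (fun i => ((hmeas i).const_mul (c i)).aemeasurable) hind hα
    (fun i => mul_nonneg (abs_nonneg _) (hσ i))
  convert hlaw using 4 with i
  rw [Real.mul_rpow (abs_nonneg _) (hσ i), one_div, Real.rpow_inv_rpow ENNReal.toReal_nonneg hα]

lemma simpleStableIntegral_map (hM : IsSymStableRandomMeasure α m P M) {β : Type*}
    (H : SimpleFunc E β) (φ : β → ℝ) (hH : ∀ p, φ p ≠ 0 → m (H ⁻¹' {p}) < ∞) :
    ∀ᵐ ω ∂P, simpleStableIntegral M (H.map φ) ω = ∑ p ∈ H.range, φ p * M (H ⁻¹' {p}) ω := by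
  classical
  have hfiber : ∀ c ∈ (H.map φ).range, ∀ᵐ ω ∂P, c * M (H.map φ ⁻¹' {c}) ω =
      ∑ p ∈ H.range with φ p = c, φ p * M (H ⁻¹' {p}) ω := by
    intro c _
    rcases eq_or_ne c 0 with rfl | hc
    · refine .of_forall fun ω => ?_
      rw [zero_mul, Finset.sum_eq_zero fun p hp => by rw [(Finset.mem_filter.1 hp).2, zero_mul]]
    · have hadd := hM.ae_biUnion_finset {p ∈ H.range | φ p = c} (fun p => H ⁻¹' {p})
        (fun p _ => H.measurableSet_fiber p)
        (fun p hp => hH p ((Finset.mem_filter.1 hp).2 ▸ hc))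
        (fun p _ q _ hpq => Disjoint.preimage _ (by simpa using hpq))
      have hunion : H.map φ ⁻¹' {c} = ⋃ p ∈ ({p ∈ H.range | φ p = c} : Finset β), H ⁻¹' {p} := by
        ext x
        simp
      filter_upwards [hadd] with ω hω
      rw [hunion, hω, Finset.mul_sum]
      exact Finset.sum_congr rfl fun p hp => by rw [(Finset.mem_filter.1 hp).2]
  filter_upwards [(ae_ball_iff (H.map φ).range.countable_toSet).2 hfiber] with ω hω
  rw [simpleStableIntegral, Finset.sum_congr rfl hω]
  exact Finset.sum_fiberwise_of_maps_to (fun p hp => by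
    rw [SimpleFunc.range_map]; exact Finset.mem_image_of_mem _ hp) _

lemma simpleStableIntegral_sub (hM : IsSymStableRandomMeasure α m P M) {F G : SimpleFunc E ℝ}
    (hF : F.FinMeasSupp m) (hG : G.FinMeasSupp m) :
    simpleStableIntegral M (F - G) =ᵐ[P]
      fun ω => simpleStableIntegral M F ω - simpleStableIntegral M G ω := by
  have hfin : ∀ p, p ≠ 0 → m (F.pair G ⁻¹' {p}) < ∞ := fun p hp =>
    (hF.pair hG).meas_preimage_singleton_ne_zero hp
  have hsub := hM.simpleStableIntegral_map (F.pair G) (fun p => p.1 - p.2)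
    fun p hp => hfin p (by rintro rfl; simp at hp)
  have hfst := hM.simpleStableIntegral_map (F.pair G) Prod.fst
    fun p hp => hfin p (by rintro rfl; simp at hp)
  have hsnd := hM.simpleStableIntegral_map (F.pair G) Prod.snd
    fun p hp => hfin p (by rintro rfl; simp at hp)
  rw [SimpleFunc.map_fst_pair] at hfst
  rw [SimpleFunc.map_snd_pair] at hsnd
  filter_upwards [hsub, hfst, hsnd] with ω hω hωF hωG
  rw [hωF, hωG, ← Finset.sum_sub_distrib]
  exact hω.trans (Finset.sum_congr rfl fun p _ => sub_mul _ _ _)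

lemma measurable_simpleStableIntegral (hM : IsSymStableRandomMeasure α m P M)
    {F : SimpleFunc E ℝ} (hF : F.FinMeasSupp m) : Measurable (simpleStableIntegral M F) := by
  refine Finset.measurable_fun_sum _ fun c _ => ?_
  rcases eq_or_ne c 0 with rfl | hc
  · simp only [zero_mul, measurable_const]
  · exact (hM.measurable _ (F.measurableSet_fiber c)
      (hF.meas_preimage_singleton_ne_zero hc)).const_mul c

lemma isSymStableLaw_simpleStableIntegral (hM : IsSymStableRandomMeasure α m P M) (hα : 0 < α)
    {F : SimpleFunc E ℝ} (hF : F.FinMeasSupp m) :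
    IsSymStableLaw α (eLpNorm F (ENNReal.ofReal α) m).toReal
      (P.map (simpleStableIntegral M F)) := by
  classical
  let s := F.range.erase 0
  have hfin : ∀ c ∈ s, m (F ⁻¹' {c}) < ∞ := fun c hc =>
    hF.meas_preimage_singleton_ne_zero (Finset.ne_of_mem_erase hc)
  have hlaw := hM.isSymStableLaw_sum hα.ne' (A := fun c : s => F ⁻¹' {c.1})
    (fun c => F.measurableSet_fiber c.1) (fun c => hfin c.1 c.2)
    (fun c d hcd => Disjoint.preimage _ (by simpa using Subtype.coe_ne_coe.2 hcd)) (fun c => c.1)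
  have hsimple : simpleStableIntegral M F = fun ω => ∑ c : s, c.1 * M (F ⁻¹' {c.1}) ω := by
    ext ω
    rw [Finset.sum_coe_sort s fun c => c * M (F ⁻¹' {c}) ω, Finset.sum_erase _ (zero_mul _),
      simpleStableIntegral]
  have hnorm : (eLpNorm F (ENNReal.ofReal α) m).toReal =
      (∑ c : s, |c.1| ^ α * (m (F ⁻¹' {c.1})).toReal) ^ (1 / α) := by
    rw [eLpNorm_eq_eLpNorm' (by simpa using hα) ENNReal.ofReal_ne_top,
      ENNReal.toReal_ofReal hα.le, SimpleFunc.eLpNorm'_eq, ← ENNReal.toReal_rpow,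
      ← Finset.sum_erase F.range (a := 0) (by simp [hα]),
      ENNReal.toReal_sum fun c hc => ENNReal.mul_ne_top
        (ENNReal.rpow_ne_top_of_nonneg hα.le enorm_ne_top) (hfin c hc).ne,
      ← Finset.sum_coe_sort]
    simp [← ENNReal.toReal_rpow, s]
  rwa [hsimple, hnorm]

end IsSymStableRandomMeasure

section QuasiNorm

variable {E F : Type*} [MeasurableSpace E] [NormedAddCommGroup F] {m : Measure E}

lemma eLpNorm_add_rpow_min_one_le {f g : E → F} (hf : AEStronglyMeasurable f m)
    (hg : AEStronglyMeasurable g m) (p : ℝ≥0∞) :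
    eLpNorm (f + g) p m ^ (min 1 p).toReal ≤
      eLpNorm f p m ^ (min 1 p).toReal + eLpNorm g p m ^ (min 1 p).toReal := by
  rcases le_total 1 p with hp | hp
  · simpa [min_eq_left hp] using eLpNorm_add_le hf hg hp
  rcases eq_or_ne p 0 with rfl | hp0
  · simp
  have hp_top : p ≠ ∞ := ne_top_of_le_ne_top ENNReal.one_ne_top hp
  have hpos : 0 < p.toReal := ENNReal.toReal_pos hp0 hp_top
  have hle : p.toReal ≤ 1 := ENNReal.toReal_le_of_le_ofReal zero_le_one (by simpa using hp)
  simp only [min_eq_right hp, eLpNorm_eq_eLpNorm' hp0 hp_top,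
    ← lintegral_rpow_enorm_eq_rpow_eLpNorm' hpos]
  calc ∫⁻ x, ‖(f + g) x‖ₑ ^ p.toReal ∂m
      ≤ ∫⁻ x, ‖f x‖ₑ ^ p.toReal + ‖g x‖ₑ ^ p.toReal ∂m := lintegral_mono fun x =>
        (ENNReal.rpow_le_rpow (enorm_add_le _ _) hpos.le).trans
          (ENNReal.rpow_add_le_add_rpow _ _ hpos.le hle)
    _ = _ := lintegral_add_left' (hf.enorm.pow_const _) _

lemma tendsto_eLpNorm_of_tendsto_eLpNorm_sub {ι : Type*} {l : Filter ι} {f : ι → E → F}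
    {g : E → F} (hf : ∀ i, AEStronglyMeasurable (f i) m) (hg : AEStronglyMeasurable g m)
    {p : ℝ≥0∞} (hfg : Tendsto (fun i => eLpNorm (f i - g) p m) l (𝓝 0)) :
    Tendsto (fun i => eLpNorm (f i) p m) l (𝓝 (eLpNorm g p m)) := by
  rcases eq_or_ne p 0 with rfl | hp
  · simpa using tendsto_const_nhds
  have hq : 0 < (min 1 p).toReal :=
    ENNReal.toReal_pos (lt_min zero_lt_one (pos_iff_ne_zero.2 hp)).ne'
      (ne_top_of_le_ne_top ENNReal.one_ne_top (min_le_left 1 p))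
  set q := (min 1 p).toReal
  have hdiff : Tendsto (fun i => eLpNorm (f i - g) p m ^ q) l (𝓝 0) := by
    simpa [hq] using hfg.ennrpow_const q
  have hupper : ∀ i, eLpNorm (f i) p m ^ q ≤ eLpNorm g p m ^ q + eLpNorm (f i - g) p m ^ q :=
    fun i => by simpa using eLpNorm_add_rpow_min_one_le hg ((hf i).sub hg) p
  have hlower : ∀ i, eLpNorm g p m ^ q - eLpNorm (f i - g) p m ^ q ≤ eLpNorm (f i) p m ^ q :=
    fun i => tsub_le_iff_right.2 <| by
      simpa [eLpNorm_sub_comm g (f i)] using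
        eLpNorm_add_rpow_min_one_le (hf i) (hg.sub (hf i)) p
  have hpow : Tendsto (fun i => eLpNorm (f i) p m ^ q) l (𝓝 (eLpNorm g p m ^ q)) :=
    tendsto_of_tendsto_of_tendsto_of_le_of_le
      (by simpa using ENNReal.Tendsto.sub tendsto_const_nhds hdiff (.inr ENNReal.zero_ne_top))
      (by simpa using tendsto_const_nhds.add hdiff) hlower hupper
  simpa [ENNReal.rpow_rpow_inv hq.ne'] using hpow.ennrpow_const q⁻¹

lemma eLpNorm_ofReal_rpow {α : ℝ} (hα : 0 < α) (f : E → F) :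
    eLpNorm f (ENNReal.ofReal α) m ^ α = ∫⁻ x, ENNReal.ofReal (‖f x‖ ^ α) ∂m := by
  rw [eLpNorm_eq_eLpNorm' (by simpa using hα) ENNReal.ofReal_ne_top,
    ENNReal.toReal_ofReal hα.le, ← lintegral_rpow_enorm_eq_rpow_eLpNorm' hα]
  simp only [← ENNReal.ofReal_rpow_of_nonneg (norm_nonneg _) hα.le, ofReal_norm]

lemma tendstoInMeasure_sub {ι : Type*} {l : Filter ι} {f f' : ι → E → F} {g g' : E → F}
    (h : TendstoInMeasure m f l g) (h' : TendstoInMeasure m f' l g') :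
    TendstoInMeasure m (fun i x => f i x - f' i x) l (fun x => g x - g' x) := by
  rw [tendstoInMeasure_iff_norm] at *
  intro ε hε
  refine tendsto_of_tendsto_of_tendsto_of_le_of_le tendsto_const_nhds
    (by simpa using (h (ε / 2) (half_pos hε)).add (h' (ε / 2) (half_pos hε)))
    (fun _ => zero_le) fun i => (measure_mono fun x hx => ?_).trans (measure_union_le _ _)
  by_contra hsmall
  simp only [Set.mem_union, Set.mem_ofPred_eq, not_or, not_le] at hx hsmall
  have htri := norm_sub_le (f i x - g x) (f' i x - g' x)
  rw [sub_sub_sub_comm] at htri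
  linarith [hsmall.1, hsmall.2]

end QuasiNorm

namespace IsStableIntegral

variable {E Ω : Type*} [MeasurableSpace E] [MeasurableSpace Ω] {α : ℝ} {m : Measure E}
  {P : Measure Ω} {M : Set E → Ω → ℝ} {f f' : E → ℝ} {X X' : Ω → ℝ}

lemma sub (hX : IsStableIntegral α m P M f X) (hX' : IsStableIntegral α m P M f' X')
    (hM : IsSymStableRandomMeasure α m P M) (hf : AEStronglyMeasurable f m)
    (hf' : AEStronglyMeasurable f' m) :
    IsStableIntegral α m P M (fun x => f x - f' x) (fun ω => X ω - X' ω) := by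
  obtain ⟨hXm, F, hF, hFf, hFX⟩ := hX
  obtain ⟨hX'm, G, hG, hGf', hGX'⟩ := hX'
  refine ⟨hXm.sub hX'm, fun n => F n - G n, fun n => (hF n).map₂ (hG n) (sub_zero 0), ?_,
    (tendstoInMeasure_sub hFX hGX').congr_left fun n =>
      (hM.simpleStableIntegral_sub (hF n) (hG n)).symm⟩
  have hlim := ENNReal.Tendsto.const_mul (hFf.add hGf')
    (.inr (ENNReal.LpAddConst_lt_top (ENNReal.ofReal α)).ne)
  rw [add_zero, mul_zero] at hlim
  refine tendsto_of_tendsto_of_tendsto_of_le_of_le tendsto_const_nhds hlim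
    (fun _ => zero_le) fun n => ?_
  have hFm := (F n).aestronglyMeasurable (μ := m)
  have hGm := (G n).aestronglyMeasurable (μ := m)
  have hsub := eLpNorm_sub_le' (hFm.sub hf) (hGm.sub hf') (ENNReal.ofReal α)
  rw [sub_sub_sub_comm] at hsub
  exact hsub

lemma isSymStableLaw [IsProbabilityMeasure P] (hX : IsStableIntegral α m P M f X)
    (hM : IsSymStableRandomMeasure α m P M) (hα : 0 < α) (hf : AEStronglyMeasurable f m) :
    IsSymStableLaw α (eLpNorm f (ENNReal.ofReal α) m).toReal (P.map X) := by
  obtain ⟨-, F, hF, hFf, hFX⟩ := hX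
  have hFm : ∀ n, AEStronglyMeasurable (F n) m := fun n => (F n).aestronglyMeasurable
  have hFp : ∀ n, MemLp (F n) (ENNReal.ofReal α) m := fun n =>
    (F n).memLp_of_finite_measure_preimage _
      fun c hc => (hF n).meas_preimage_singleton_ne_zero hc
  obtain ⟨n, hn⟩ := (hFf.eventually_lt_const ENNReal.zero_lt_top).exists
  have hfp : MemLp f (ENNReal.ofReal α) m := by
    simpa [Pi.sub_def] using (hFp n).sub (⟨(hFm n).sub hf, hn⟩ : MemLp (fun x => F n x - f x) _ m)
  exact IsSymStableLaw.of_tendstoInMeasure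
    (fun n => hM.isSymStableLaw_simpleStableIntegral hα (hF n))
    (fun n => (hM.measurable_simpleStableIntegral (hF n)).aemeasurable) hα hFX
    ((ENNReal.tendsto_toReal hfp.eLpNorm_ne_top).comp
      (tendsto_eLpNorm_of_tendsto_eLpNorm_sub hFm hf hFf))

lemma measure_abs_gt_le [IsProbabilityMeasure P] (hX : IsStableIntegral α m P M f X)
    (hM : IsSymStableRandomMeasure α m P M) (hα : 0 < α) (hf : AEStronglyMeasurable f m) {r : ℝ}
    (hr : 0 < r) :
    P {ω | r < |X ω|} ≤
      ENNReal.ofReal (2 * (2 / r) ^ α) * ∫⁻ x, ENNReal.ofReal (|f x| ^ α) ∂m := by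
  have := Measure.isProbabilityMeasure_map (μ := P) hX.1.aemeasurable
  set σ := eLpNorm f (ENNReal.ofReal α) m with hσ
  have htail := (hX.isSymStableLaw hM hα hf).measureReal_abs_gt_le hα.le ENNReal.toReal_nonneg hr
  calc P {ω | r < |X ω|} = ENNReal.ofReal ((P.map X).real {x | r < |x|}) := by
        rw [ofReal_measureReal,
          Measure.map_apply hX.1 (measurableSet_lt measurable_const continuous_abs.measurable)]
        rfl
    _ ≤ ENNReal.ofReal (2 * (2 * σ.toReal / r) ^ α) := ENNReal.ofReal_le_ofReal htail
    _ = ENNReal.ofReal (2 * (2 / r) ^ α) * ENNReal.ofReal (σ ^ α).toReal := by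
        rw [← ENNReal.ofReal_mul (by positivity), ← ENNReal.toReal_rpow, mul_div_right_comm,
          Real.mul_rpow (by positivity) ENNReal.toReal_nonneg, mul_assoc]
    _ ≤ ENNReal.ofReal (2 * (2 / r) ^ α) * σ ^ α := by
        gcongr
        exact ENNReal.ofReal_toReal_le
    _ = _ := by rw [hσ, eLpNorm_ofReal_rpow hα]; rfl

end IsStableIntegral

lemma exists_holderOnWith_of_small_scale {V T : Type*} [SeminormedAddCommGroup V]
    [NormedSpace ℝ V] [PseudoEMetricSpace T] {s : Set V} (hs : Convex ℝ s)
    (hbdd : Bornology.IsBounded s) {z : V → T} {C θ : ℝ≥0} {δ : ℝ} (hδ : 0 < δ)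
    (hz : ∀ x ∈ s, ∀ y ∈ s, dist x y ≤ δ → edist (z x) (z y) ≤ C * edist x y ^ (θ : ℝ)) :
    ∃ K : ℝ≥0, HolderOnWith K θ z s := by
  obtain ⟨D, hD⟩ := Metric.isBounded_iff.1 hbdd
  obtain ⟨n, hn⟩ := exists_nat_gt (max 0 (D / δ))
  have hn0 : (0 : ℝ) < n := (le_max_left _ _).trans_lt hn
  have hDn : D < n * δ := (div_lt_iff₀ hδ).1 ((le_max_right _ _).trans_lt hn)
  refine ⟨n * C, fun x hx y hy => ?_⟩
  let w : ℕ → V := fun i => AffineMap.lineMap x y ((i : ℝ) / n)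
  have hw : ∀ i ≤ n, w i ∈ s := fun i hi =>
    hs.lineMap_mem hx hy ⟨by positivity, (div_le_one hn0).2 (by exact_mod_cast hi)⟩
  have hstep : ∀ i, dist (w i) (w (i + 1)) = dist x y / n := fun i => by
    rw [dist_lineMap_lineMap, Real.dist_eq, ← sub_div, Nat.cast_succ, sub_add_cancel_left,
      abs_div, abs_neg, abs_one, Nat.abs_cast, one_div_mul_eq_div]
  have hle : ∀ i < n, edist (z (w i)) (z (w (i + 1))) ≤ C * edist x y ^ (θ : ℝ) := by
    intro i hi
    have hδi : dist (w i) (w (i + 1)) ≤ δ := by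
      rw [hstep, div_le_iff₀ hn0, mul_comm]
      exact (hD hx hy).trans hDn.le
    have hxy : edist (w i) (w (i + 1)) ≤ edist x y := by
      rw [edist_dist, edist_dist, hstep]
      exact ENNReal.ofReal_le_ofReal
        (div_le_self dist_nonneg (by exact_mod_cast Nat.one_le_iff_ne_zero.2 (by omega)))
    exact (hz _ (hw i hi.le) _ (hw (i + 1) hi) hδi).trans (by gcongr)
  calc edist (z x) (z y) = edist (z (w 0)) (z (w n)) := by simp [w, hn0.ne']
    _ ≤ ∑ _i ∈ Finset.range n, C * edist x y ^ (θ : ℝ) :=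
        edist_le_range_sum_of_edist_le (f := z ∘ w) n fun hi => hle _ hi
    _ = (n * C : ℝ≥0) * edist x y ^ (θ : ℝ) := by
        simp [mul_assoc]

lemma continuous_of_forall_holderOnWith_Icc {T : Type*} [PseudoEMetricSpace T] {z : ℝ → T}
    {θ : ℝ≥0} (hθ : 0 < θ) (hz : ∀ a b, ∃ C : ℝ≥0, HolderOnWith C θ z (Set.Icc a b)) :
    Continuous z := by
  refine continuous_iff_continuousAt.2 fun t => ?_
  obtain ⟨C, hC⟩ := hz (t - 1) (t + 1)
  exact (hC.continuousOn hθ).continuousAt (Icc_mem_nhds (by linarith) (by linarith))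

lemma exists_holderOnWith_of_le {V T : Type*} [PseudoMetricSpace V] [PseudoEMetricSpace T]
    {s : Set V} (hs : Bornology.IsBounded s) {z : V → T} {C θ η : ℝ≥0}
    (hz : HolderOnWith C η z s) (hθ : θ ≤ η) : ∃ K : ℝ≥0, HolderOnWith K θ z s := by
  obtain ⟨D, hD⟩ := Metric.isBounded_iff_nndist.1 hs
  exact ⟨_, hz.of_le (D := D) (fun x hx y hy => by
    rw [edist_nndist]; exact_mod_cast hD hx hy) hθ⟩

/-- The largest dyadic number of level `n` that is at most `t`. -/
noncomputable def dyadicFloor (n : ℕ) (t : ℝ) : ℝ := (⌊2 ^ n * t⌋ : ℝ) / 2 ^ n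

lemma two_pow_mul_dyadicFloor (n : ℕ) (t : ℝ) : 2 ^ n * dyadicFloor n t = ⌊2 ^ n * t⌋ :=
  mul_div_cancel₀ _ (by positivity)

lemma dyadicFloor_le (n : ℕ) (t : ℝ) : dyadicFloor n t ≤ t :=
  (div_le_iff₀' (by positivity)).2 (Int.floor_le _)

lemma dyadicFloor_succ_dyadicFloor (n : ℕ) (t : ℝ) :
    dyadicFloor (n + 1) (dyadicFloor n t) = dyadicFloor n t := by
  have hscaled : 2 ^ (n + 1) * dyadicFloor n t = (2 * ⌊2 ^ n * t⌋ : ℤ) := by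
    rw [pow_succ', mul_assoc, two_pow_mul_dyadicFloor, Int.cast_mul, Int.cast_ofNat]
  rw [dyadicFloor, hscaled, Int.floor_intCast, ← hscaled]
  exact mul_div_cancel_left₀ _ (by positivity)

lemma dist_dyadicFloor_le (n : ℕ) (t : ℝ) : dist (dyadicFloor n t) t ≤ (1 / 2) ^ n := by
  rw [dist_comm, Real.dist_eq, abs_of_nonneg (sub_nonneg.2 (dyadicFloor_le n t)), sub_le_comm,
    dyadicFloor, le_div_iff₀' (by positivity), mul_sub, ← mul_pow,
    mul_one_div_cancel two_ne_zero, one_pow]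
  exact (Int.sub_one_lt_floor _).le

lemma tendsto_dyadicFloor (t : ℝ) : Tendsto (fun n => dyadicFloor n t) atTop (𝓝 t) :=
  tendsto_iff_dist_tendsto_zero.2 <| squeeze_zero (fun _ => dist_nonneg)
    (fun n => dist_dyadicFloor_le n t)
    (tendsto_pow_atTop_nhds_zero_of_lt_one (by norm_num) (by norm_num))

/-- On `[-N, N]`, the increments of `f` between neighbouring dyadic numbers of level `n ≥ n₀` are
at most `q ^ n`. -/
def DyadicIncrementBound {S : Type*} [PseudoMetricSpace S] (f : ℝ → S) (q : ℝ) (N n₀ : ℕ) : Prop :=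
  ∀ n ≥ n₀, ∀ k : ℤ, |k| ≤ N * 2 ^ n → dist (f (k / 2 ^ n)) (f ((k + 1 : ℤ) / 2 ^ n)) ≤ q ^ n

namespace DyadicIncrementBound

variable {S : Type*} [PseudoMetricSpace S] {f : ℝ → S} {q : ℝ} {N n₀ n : ℕ} {s t : ℝ}

lemma dist_dyadicFloor_le_pow (hf : DyadicIncrementBound f q N n₀) (hq : 0 ≤ q) (hn : n₀ ≤ n)
    (hs : |s| + 1 ≤ N) (hst : s ≤ t) (hts : 2 ^ n * t < ⌊2 ^ n * s⌋ + 2) :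
    dist (f (dyadicFloor n s)) (f (dyadicFloor n t)) ≤ q ^ n := by
  have hlower : ⌊2 ^ n * s⌋ ≤ ⌊2 ^ n * t⌋ := Int.floor_mono (by gcongr)
  have hupper : ⌊2 ^ n * t⌋ < ⌊2 ^ n * s⌋ + 2 := Int.floor_lt.2 (by exact_mod_cast hts)
  obtain heq | hsucc : ⌊2 ^ n * t⌋ = ⌊2 ^ n * s⌋ ∨ ⌊2 ^ n * t⌋ = ⌊2 ^ n * s⌋ + 1 := by omega
  · rw [dyadicFloor, dyadicFloor, heq, dist_self]
    positivity
  · rw [dyadicFloor, dyadicFloor, hsucc]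
    refine hf n hn _ ?_
    have hfloor : |(⌊2 ^ n * s⌋ : ℝ)| ≤ N * 2 ^ n := by
      have hdist := dist_dyadicFloor_le n s
      have hpow : (1 / 2 : ℝ) ^ n ≤ 1 := pow_le_one₀ (by norm_num) (by norm_num)
      rw [Real.dist_eq] at hdist
      rw [← two_pow_mul_dyadicFloor, abs_mul, abs_of_pos (by positivity : (0 : ℝ) < 2 ^ n),
        mul_comm]
      gcongr
      linarith [abs_sub_abs_le_abs_sub (dyadicFloor n s) s]
    exact_mod_cast hfloor

lemma dist_succ_le (hf : DyadicIncrementBound f q N n₀) (hq : 0 ≤ q) (hn : n₀ ≤ n)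
    (ht : |t| + 2 ≤ N) :
    dist (f (dyadicFloor n t)) (f (dyadicFloor (n + 1) t)) ≤ q ^ (n + 1) := by
  have hdist := dist_dyadicFloor_le n t
  have hpow : (1 / 2 : ℝ) ^ n ≤ 1 := pow_le_one₀ (by norm_num) (by norm_num)
  rw [Real.dist_eq] at hdist
  rw [← dyadicFloor_succ_dyadicFloor]
  refine hf.dist_dyadicFloor_le_pow hq (by omega)
    (by linarith [abs_sub_abs_le_abs_sub (dyadicFloor n t) t]) (dyadicFloor_le n t) ?_
  rw [← two_pow_mul_dyadicFloor (n + 1), dyadicFloor_succ_dyadicFloor, pow_succ', mul_assoc,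
    mul_assoc, two_pow_mul_dyadicFloor]
  linarith [Int.lt_floor_add_one (2 ^ n * t)]

lemma dist_add_le (hf : DyadicIncrementBound f q N n₀) (hq : 0 ≤ q) (hn : n₀ ≤ n)
    (ht : |t| + 2 ≤ N) (i : ℕ) :
    dist (f (dyadicFloor (i + n) t)) (f (dyadicFloor (i + 1 + n) t)) ≤ q ^ (n + 1) * q ^ i := by
  rw [add_right_comm i 1 n, ← pow_add, show n + 1 + i = i + n + 1 by ring]
  exact hf.dist_succ_le hq (by omega) ht

lemma exists_tendsto [CompleteSpace S] (hf : DyadicIncrementBound f q N n₀) (hq : 0 ≤ q)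
    (hq1 : q < 1) (ht : |t| + 2 ≤ N) :
    ∃ a, Tendsto (fun n => f (dyadicFloor n t)) atTop (𝓝 a) := by
  obtain ⟨a, ha⟩ := cauchySeq_tendsto_of_complete
    (cauchySeq_of_le_geometric q _ hq1 (hf.dist_add_le hq le_rfl ht))
  exact ⟨a, (tendsto_add_atTop_iff_nat n₀).1 ha⟩

lemma dist_limit_le (hf : DyadicIncrementBound f q N n₀) (hq : 0 ≤ q) (hq1 : q < 1) (hn : n₀ ≤ n)
    (ht : |t| + 2 ≤ N) {a : S} (ha : Tendsto (fun n => f (dyadicFloor n t)) atTop (𝓝 a)) :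
    dist (f (dyadicFloor n t)) a ≤ q ^ (n + 1) / (1 - q) := by
  simpa only [zero_add] using
    dist_le_of_le_geometric_of_tendsto₀ q _ hq1 (hf.dist_add_le hq hn ht)
      ((tendsto_add_atTop_iff_nat n).2 ha)

lemma dist_limits_le (hf : DyadicIncrementBound f q N n₀) (hq : 0 ≤ q) (hq1 : q < 1)
    {z : ℝ → S} (hz : ∀ t, Tendsto (fun n => f (dyadicFloor n t)) atTop (𝓝 (z t)))
    (hn : n₀ ≤ n) (hs : |s| + 2 ≤ N) (ht : |t| + 2 ≤ N) (hst : dist s t ≤ (1 / 2) ^ n) :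
    dist (z s) (z t) ≤ (1 + q) / (1 - q) * q ^ n := by
  wlog hle : s ≤ t generalizing s t
  · rw [dist_comm]
    exact this ht hs (by rwa [dist_comm]) (le_of_not_ge hle)
  have hts : 2 ^ n * t < ⌊2 ^ n * s⌋ + 2 := by
    have hscale : 2 ^ n * (t - s) ≤ 1 := by
      rw [dist_comm, Real.dist_eq, abs_of_nonneg (sub_nonneg.2 hle), one_div, inv_pow] at hst
      exact (le_inv_mul_iff₀ (by positivity)).1 (by simpa using hst)
    linarith [Int.lt_floor_add_one (2 ^ n * s)]
  have hmid := hf.dist_dyadicFloor_le_pow hq hn (by linarith) hle hts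
  have hs' := hf.dist_limit_le hq hq1 hn hs (hz s)
  have ht' := hf.dist_limit_le hq hq1 hn ht (hz t)
  calc dist (z s) (z t)
      ≤ dist (f (dyadicFloor n s)) (z s) + dist (f (dyadicFloor n s)) (f (dyadicFloor n t)) +
          dist (f (dyadicFloor n t)) (z t) := by
        rw [dist_comm _ (z s)]
        exact dist_triangle4 _ _ _ _
    _ ≤ q ^ (n + 1) / (1 - q) + q ^ n + q ^ (n + 1) / (1 - q) := by gcongr
    _ = (1 + q) / (1 - q) * q ^ n := by
        have : 1 - q ≠ 0 := (sub_pos.2 hq1).ne'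
        field_simp
        ring

lemma dist_limits_le_rpow {θ : ℝ} (hθ : 0 < θ) (hf : DyadicIncrementBound f ((1 / 2) ^ θ) N n₀)
    {z : ℝ → S} (hz : ∀ t, Tendsto (fun n => f (dyadicFloor n t)) atTop (𝓝 (z t)))
    (hs : |s| + 2 ≤ N) (ht : |t| + 2 ≤ N) (hst : dist s t ≤ (1 / 2) ^ n₀) :
    dist (z s) (z t) ≤ (1 + (1 / 2) ^ θ) / (1 - (1 / 2) ^ θ) * 2 ^ θ * dist s t ^ θ := by
  have hq : (1 / 2 : ℝ) ^ θ < 1 := Real.rpow_lt_one (by norm_num) (by norm_num) hθ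
  rcases eq_or_ne s t with rfl | hne
  · simp [hθ.ne']
  obtain ⟨n, hlower, hupper⟩ := exists_nat_pow_near_of_lt_one (dist_pos.2 hne)
    (hst.trans (pow_le_one₀ (by norm_num) (by norm_num))) (y := (1 / 2 : ℝ))
    (by norm_num) (by norm_num)
  have hn : n₀ ≤ n := Nat.lt_succ_iff.1 <|
    (pow_lt_pow_iff_right_of_lt_one₀ (by norm_num) (by norm_num)).1 (hlower.trans_le hst)
  have hpow : ((1 / 2 : ℝ) ^ θ) ^ n ≤ 2 ^ θ * dist s t ^ θ := by
    rw [← Real.rpow_natCast, ← Real.rpow_mul (by norm_num), mul_comm θ,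
      Real.rpow_mul (by norm_num), Real.rpow_natCast, ← Real.mul_rpow (by norm_num) dist_nonneg]
    rw [pow_succ] at hlower
    exact Real.rpow_le_rpow (by positivity) (by linarith) hθ.le
  calc dist (z s) (z t)
      ≤ (1 + (1 / 2) ^ θ) / (1 - (1 / 2) ^ θ) * ((1 / 2 : ℝ) ^ θ) ^ n :=
        hf.dist_limits_le (by positivity) hq hz hn hs ht hupper
    _ ≤ (1 + (1 / 2) ^ θ) / (1 - (1 / 2) ^ θ) * (2 ^ θ * dist s t ^ θ) := by
        have := sub_pos.2 hq
        gcongr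
    _ = _ := (mul_assoc _ _ _).symm

end DyadicIncrementBound

/-- `f` is `θ`-Hölder along neighbouring dyadic numbers: on each bounded interval the increments
of `f` over dyadic steps `2 ^ (-n)` are at most `2 ^ (-θ n)` for all large `n`. -/
def IsDyadicHolder {S : Type*} [PseudoMetricSpace S] (f : ℝ → S) (θ : ℝ≥0) : Prop :=
  ∀ N : ℕ, ∃ n₀, DyadicIncrementBound f ((1 / 2) ^ (θ : ℝ)) N n₀

lemma isDyadicHolder_const {S : Type*} [PseudoMetricSpace S] (x : S) (θ : ℝ≥0) :
    IsDyadicHolder (fun _ => x) θ := fun _ =>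
  ⟨0, fun _ _ _ _ => by
    rw [dist_self]
    positivity⟩

namespace IsDyadicHolder

variable {S : Type*} [PseudoMetricSpace S] {f : ℝ → S} {θ : ℝ≥0}

lemma exists_tendsto [CompleteSpace S] (hf : IsDyadicHolder f θ) (hθ : 0 < θ) (t : ℝ) :
    ∃ a, Tendsto (fun n => f (dyadicFloor n t)) atTop (𝓝 a) := by
  obtain ⟨N, hN⟩ := exists_nat_ge (|t| + 2)
  obtain ⟨n₀, hn₀⟩ := hf N
  exact hn₀.exists_tendsto (by positivity) (Real.rpow_lt_one (by norm_num) (by norm_num) hθ) hN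

lemma exists_holderOnWith_Icc (hf : IsDyadicHolder f θ) (hθ : 0 < θ) {z : ℝ → S}
    (hz : ∀ t, Tendsto (fun n => f (dyadicFloor n t)) atTop (𝓝 (z t))) (a b : ℝ) :
    ∃ C : ℝ≥0, HolderOnWith C θ z (Set.Icc a b) := by
  obtain ⟨N, hN⟩ := exists_nat_ge (max |a| |b| + 2)
  obtain ⟨n₀, hn₀⟩ := hf N
  have hmem : ∀ t ∈ Set.Icc a b, |t| + 2 ≤ N := fun t ht =>
    (by gcongr; exact abs_le_max_abs_abs ht.1 ht.2 : |t| + 2 ≤ max |a| |b| + 2).trans hN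
  set C : ℝ := (1 + (1 / 2) ^ (θ : ℝ)) / (1 - (1 / 2) ^ (θ : ℝ)) * 2 ^ (θ : ℝ)
  have hC0 : 0 ≤ C := by
    have := sub_pos.2 (Real.rpow_lt_one (by norm_num) (by norm_num) hθ : (1 / 2 : ℝ) ^ (θ : ℝ) < 1)
    positivity
  refine exists_holderOnWith_of_small_scale (convex_Icc a b) (Metric.isBounded_Icc a b)
    (C := C.toNNReal) (δ := (1 / 2) ^ n₀) (by positivity) fun s hs t ht hst => ?_
  rw [edist_dist, edist_dist, ENNReal.ofReal_rpow_of_nonneg dist_nonneg θ.coe_nonneg,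
    ← ENNReal.ofReal_coe_nnreal, Real.coe_toNNReal C hC0, ← ENNReal.ofReal_mul hC0]
  exact ENNReal.ofReal_le_ofReal (hn₀.dist_limits_le_rpow hθ hz (hmem s hs) (hmem t ht) hst)

end IsDyadicHolder

lemma exists_ae_eq_forall_path {ι S Ω : Type*} [Nonempty ι] [MeasurableSpace S]
    [MeasurableSpace Ω] {P : Measure Ω} {Y : ι → Ω → S} (hY : ∀ t, Measurable (Y t))
    {p : (ι → S) → Prop} (hp : ∀ᵐ ω ∂P, p fun t => Y t ω) (hconst : ∀ x, p fun _ => x) :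
    ∃ Y' : ι → Ω → S, (∀ t, Measurable (Y' t)) ∧ (∀ᵐ ω ∂P, ∀ t, Y' t ω = Y t ω) ∧
      ∀ ω, p fun t => Y' t ω := by
  classical
  obtain ⟨t₀⟩ := ‹Nonempty ι›
  obtain ⟨B, hB, hBm, hB0⟩ := exists_measurable_superset_of_null hp
  refine ⟨fun t => B.piecewise (Y t₀) (Y t), fun t => (hY t₀).piecewise hBm (hY t), ?_,
    fun ω => ?_⟩
  · filter_upwards [measure_eq_zero_iff_ae_notMem.1 hB0] with ω hω t
    exact Set.piecewise_eq_of_notMem _ _ _ hω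
  · by_cases hω : ω ∈ B
    · simpa only [Set.piecewise_eq_of_mem _ _ _ hω] using hconst (Y t₀ ω)
    · have hpath : p fun t => Y t ω := by_contra fun hnot => hω (hB hnot)
      simpa only [Set.piecewise_eq_of_notMem _ _ _ hω] using hpath

/-- The weak-type version of Kolmogorov's continuity condition: the increments of `Y` over
distances less than `δ` have tails of order `r ^ (-α)` with a constant of order
`dist s t ^ lam`. -/
def HasWeakIncrementBound {S Ω : Type*} [PseudoMetricSpace S] [MeasurableSpace Ω] (P : Measure Ω)
    (Y : ℝ → Ω → S) (α lam : ℝ) (K : ℝ≥0) (δ : ℝ) : Prop :=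
  ∀ s t r : ℝ, dist s t < δ → 0 < r →
    P {ω | r < dist (Y s ω) (Y t ω)} ≤ K * ENNReal.ofReal (dist s t ^ lam * r ^ (-α))

/-- `Y` has a measurable modification whose paths are continuous and, on every bounded interval,
`θ`-Hölder for every exponent `θ < γ`. -/
def HasHolderModification {S Ω : Type*} [PseudoMetricSpace S] [MeasurableSpace S]
    [MeasurableSpace Ω] (P : Measure Ω) (Y : ℝ → Ω → S) (γ : ℝ) : Prop :=
  ∃ Z : ℝ → Ω → S,
    (∀ t, Measurable (Z t)) ∧
    (∀ t, Z t =ᵐ[P] Y t) ∧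
    (∀ ω, Continuous (fun t => Z t ω)) ∧
    (∀ ω, ∀ θ : ℝ≥0, (θ : ℝ) < γ → ∀ a b : ℝ, ∃ C : ℝ≥0,
      HolderOnWith C θ (fun t => Z t ω) (Set.Icc a b))

lemma two_mul_half_rpow_mul_rpow_neg_lt_one {α lam θ : ℝ} (hα : 0 < α) (hθ : θ < (lam - 1) / α) :
    2 * (1 / 2) ^ lam * ((1 / 2 : ℝ) ^ θ) ^ (-α) < 1 := by
  have hbase : 2 * (1 / 2) ^ lam * ((1 / 2 : ℝ) ^ θ) ^ (-α) = (1 / 2) ^ (lam - 1 - θ * α) := by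
    rw [← Real.rpow_mul (by norm_num), Real.rpow_sub (by norm_num), Real.rpow_sub (by norm_num),
      Real.rpow_one, mul_neg, Real.rpow_neg (by norm_num)]
    ring
  rw [hbase]
  exact Real.rpow_lt_one (by norm_num) (by norm_num) (sub_pos.2 ((lt_div_iff₀ hα).1 hθ))

namespace HasWeakIncrementBound

variable {Ω : Type*} [MeasurableSpace Ω] {P : Measure Ω} {α lam δ q : ℝ} {K : ℝ≥0}

section PseudoMetricSpace

variable {S : Type*} [PseudoMetricSpace S] {Y : ℝ → Ω → S}

lemma measure_dyadic_step_gt_le (h : HasWeakIncrementBound P Y α lam K δ) (hq : 0 < q) {n : ℕ}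
    (hn : (1 / 2) ^ n < δ) (k : ℤ) :
    P {ω | q ^ n < dist (Y (k / 2 ^ n) ω) (Y ((k + 1 : ℤ) / 2 ^ n) ω)} ≤
      K * ENNReal.ofReal ((1 / 2) ^ lam * q ^ (-α)) ^ n := by
  have hdist : dist ((k : ℝ) / 2 ^ n) ((k + 1 : ℤ) / 2 ^ n) = (1 / 2) ^ n := by
    rw [Real.dist_eq, ← sub_div, Int.cast_add, Int.cast_one, sub_add_cancel_left, abs_div,
      abs_neg, abs_one, abs_of_pos (by positivity), one_div_pow]
  have hstep := h (k / 2 ^ n) ((k + 1 : ℤ) / 2 ^ n) (q ^ n) (by rwa [hdist]) (by positivity)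
  rwa [hdist, ← Real.rpow_pow_comm (by norm_num), ← Real.rpow_pow_comm hq.le, ← mul_pow,
    ENNReal.ofReal_pow (by positivity)] at hstep

lemma measure_exists_dyadic_step_gt_le (h : HasWeakIncrementBound P Y α lam K δ) (hq : 0 < q)
    (N : ℕ) {n : ℕ} (hn : (1 / 2) ^ n < δ) :
    P {ω | ∃ k : ℤ, |k| ≤ N * 2 ^ n ∧
        q ^ n < dist (Y (k / 2 ^ n) ω) (Y ((k + 1 : ℤ) / 2 ^ n) ω)} ≤
      (2 * N + 1) * K * ENNReal.ofReal (2 * (1 / 2) ^ lam * q ^ (-α)) ^ n := by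
  let I : Finset ℤ := Finset.Icc (-(N * 2 ^ n)) (N * 2 ^ n)
  have hcard : I.card ≤ (2 * N + 1) * 2 ^ n := by
    have hpow := Nat.one_le_two_pow (n := n)
    have hI : (I.card : ℤ) = 2 * (N * 2 ^ n) + 1 := by
      rw [Int.card_Icc, sub_neg_eq_add, Int.toNat_of_nonneg (by positivity)]
      ring
    zify at hpow ⊢
    linarith
  have hunion : {ω | ∃ k : ℤ, |k| ≤ N * 2 ^ n ∧
      q ^ n < dist (Y (k / 2 ^ n) ω) (Y ((k + 1 : ℤ) / 2 ^ n) ω)} ⊆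
      ⋃ k ∈ I, {ω | q ^ n < dist (Y (k / 2 ^ n) ω) (Y ((k + 1 : ℤ) / 2 ^ n) ω)} := by
    rintro ω ⟨k, hk, hω⟩
    exact Set.mem_iUnion₂.2 ⟨k, Finset.mem_Icc.2 (abs_le.1 hk), hω⟩
  calc P {ω | ∃ k : ℤ, |k| ≤ N * 2 ^ n ∧
        q ^ n < dist (Y (k / 2 ^ n) ω) (Y ((k + 1 : ℤ) / 2 ^ n) ω)}
      ≤ ∑ _k ∈ I, K * ENNReal.ofReal ((1 / 2) ^ lam * q ^ (-α)) ^ n :=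
        (measure_mono hunion).trans <| (measure_biUnion_finset_le _ _).trans <|
          Finset.sum_le_sum fun k _ => h.measure_dyadic_step_gt_le hq hn k
    _ ≤ ((2 * N + 1) * 2 ^ n : ℕ) * (K * ENNReal.ofReal ((1 / 2) ^ lam * q ^ (-α)) ^ n) := by
        rw [Finset.sum_const, nsmul_eq_mul]
        gcongr
    _ = (2 * N + 1) * K * ENNReal.ofReal (2 * (1 / 2) ^ lam * q ^ (-α)) ^ n := by
        rw [mul_assoc 2, ENNReal.ofReal_mul zero_le_two, mul_pow, ENNReal.ofReal_ofNat]
        push_cast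
        ring

lemma ae_exists_dyadicIncrementBound (h : HasWeakIncrementBound P Y α lam K δ) (hδ : 0 < δ)
    (hq : 0 < q) (hq1 : 2 * (1 / 2) ^ lam * q ^ (-α) < 1) (N : ℕ) :
    ∀ᵐ ω ∂P, ∃ n₀, DyadicIncrementBound (fun t => Y t ω) q N n₀ := by
  obtain ⟨n₁, hn₁⟩ := exists_pow_lt_of_lt_one hδ (by norm_num : (1 / 2 : ℝ) < 1)
  set ρ := ENNReal.ofReal (2 * (1 / 2) ^ lam * q ^ (-α))
  have hρ : ρ < 1 := ENNReal.ofReal_lt_one.2 hq1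
  let bad : ℕ → Set Ω := fun n => {ω | ∃ k : ℤ, |k| ≤ N * 2 ^ n ∧
    q ^ n < dist (Y (k / 2 ^ n) ω) (Y ((k + 1 : ℤ) / 2 ^ n) ω)}
  have hbad : ∀ n, P (bad (n + n₁)) ≤ (2 * N + 1) * K * ρ ^ n₁ * ρ ^ n := fun n => by
    rw [mul_assoc, ← pow_add, add_comm n₁]
    exact h.measure_exists_dyadic_step_gt_le hq N
      ((pow_le_pow_of_le_one (by norm_num) (by norm_num) (Nat.le_add_left n₁ n)).trans_lt hn₁)
  have hsum : ∑' n, P (bad (n + n₁)) ≠ ∞ := by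
    refine ne_top_of_le_ne_top ?_ (ENNReal.tsum_le_tsum hbad)
    rw [ENNReal.tsum_mul_left, ENNReal.tsum_geometric]
    have : (1 - ρ)⁻¹ ≠ ∞ := ENNReal.inv_ne_top.2 (tsub_pos_of_lt hρ).ne'
    finiteness
  filter_upwards [ae_eventually_notMem hsum] with ω hω
  obtain ⟨n₂, hn₂⟩ := eventually_atTop.1 hω
  refine ⟨n₂ + n₁, fun n hn k hk => not_lt.1 fun hgt => ?_⟩
  obtain ⟨j, rfl⟩ := Nat.exists_eq_add_of_le' (le_of_add_le_right hn)
  exact hn₂ j (by omega) ⟨k, hk, hgt⟩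

lemma ae_isDyadicHolder (h : HasWeakIncrementBound P Y α lam K δ) (hδ : 0 < δ) (hα : 0 < α)
    {θ : ℝ≥0} (hθ : θ < (lam - 1) / α) : ∀ᵐ ω ∂P, IsDyadicHolder (fun t => Y t ω) θ :=
  ae_all_iff.2 fun N =>
    h.ae_exists_dyadicIncrementBound hδ (by positivity)
      (two_mul_half_rpow_mul_rpow_neg_lt_one hα hθ) N

lemma tendstoInMeasure {ι : Type*} {l : Filter ι} (h : HasWeakIncrementBound P Y α lam K δ)
    (hδ : 0 < δ) (hlam : 0 < lam) {s : ι → ℝ} {t : ℝ} (hs : Tendsto s l (𝓝 t)) :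
    TendstoInMeasure P (fun i => Y (s i)) l (Y t) := by
  rw [tendstoInMeasure_iff_dist]
  intro ε hε
  have hdist := tendsto_iff_dist_tendsto_zero.1 hs
  have hlim : Tendsto
      (fun i => K * ENNReal.ofReal (dist (s i) t ^ lam * (ε / 2) ^ (-α))) l (𝓝 0) := by
    have hpow := (hdist.rpow_const (p := lam) (.inr hlam.le)).mul_const ((ε / 2) ^ (-α))
    rw [Real.zero_rpow hlam.ne', zero_mul] at hpow
    simpa using ENNReal.Tendsto.const_mul (ENNReal.tendsto_ofReal hpow)
      (.inr (ENNReal.coe_ne_top (r := K)))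
  refine tendsto_of_tendsto_of_tendsto_of_le_of_le' tendsto_const_nhds hlim
    (Eventually.of_forall fun _ => zero_le) ?_
  filter_upwards [hdist.eventually_lt_const hδ] with i hi
  exact (measure_mono fun ω hω => (half_lt_self hε).trans_le hω).trans
    (h (s i) t (ε / 2) hi (half_pos hε))

variable [MetricSpace S] [CompleteSpace S] [MeasurableSpace S] [BorelSpace S] {Y : ℝ → Ω → S}

end PseudoMetricSpace

theorem hasHolderModification {S : Type*} [MetricSpace S] [CompleteSpace S] [MeasurableSpace S]
    [BorelSpace S] {Y : ℝ → Ω → S} (h : HasWeakIncrementBound P Y α lam K δ) (hδ : 0 < δ)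
    (hα : 0 < α) (hlam : 1 < lam) (hY : ∀ t, Measurable (Y t)) :
    HasHolderModification P Y ((lam - 1) / α) := by
  have hγ : 0 < (lam - 1) / α := div_pos (sub_pos.2 hlam) hα
  obtain ⟨v, -, hv, hvlim⟩ := exists_seq_strictMono_tendsto' (Real.toNNReal_pos.2 hγ)
  obtain ⟨Y', hY', hY'Y, hholder⟩ := exists_ae_eq_forall_path hY
    (p := fun f => ∀ j, IsDyadicHolder f (v j))
    (ae_all_iff.2 fun j => h.ae_isDyadicHolder hδ hα (Real.lt_toNNReal_iff_coe_lt.1 (hv j).2))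
    fun x j => isDyadicHolder_const x (v j)
  choose Z hZ using fun t ω => (hholder ω 0).exists_tendsto (hv 0).1 t
  have hpath : ∀ ω j a b, ∃ C : ℝ≥0, HolderOnWith C (v j) (fun t => Z t ω) (Set.Icc a b) :=
    fun ω j => (hholder ω j).exists_holderOnWith_Icc (hv j).1 fun t => hZ t ω
  refine ⟨Z, fun t => measurable_of_tendsto_metrizable (fun n => hY' (dyadicFloor n t))
    (tendsto_pi_nhds.2 (hZ t)), fun t => ?_,
    fun ω => continuous_of_forall_holderOnWith_Icc (hv 0).1 (hpath ω 0), fun ω θ hθ a b => ?_⟩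
  · obtain ⟨n, hn, hlim⟩ := (h.tendstoInMeasure hδ (zero_lt_one.trans hlam)
      (tendsto_dyadicFloor t)).exists_seq_tendsto_ae
    filter_upwards [hY'Y, hlim] with ω hω hlimω
    refine tendsto_nhds_unique ((hZ t ω).comp hn.tendsto_atTop) ?_
    simpa only [Function.comp_def, hω] using hlimω
  · obtain ⟨j, hj⟩ :=
      (hvlim.eventually_const_lt (Real.lt_toNNReal_iff_coe_lt.2 hθ)).exists
    obtain ⟨C, hC⟩ := hpath ω j a b
    exact exists_holderOnWith_of_le (Metric.isBounded_Icc a b) hC hj.le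

end HasWeakIncrementBound

lemma hasWeakIncrementBound_of_isStableIntegral {E Ω : Type*} [MeasurableSpace E]
    [MeasurableSpace Ω] {P : Measure Ω} [IsProbabilityMeasure P] {α : ℝ} (hα : 0 < α)
    {m : Measure E} {M : Set E → Ω → ℝ} (hM : IsSymStableRandomMeasure α m P M)
    {f : ℝ → E → ℝ} (hf : ∀ t, AEStronglyMeasurable (f t) m) {Y : ℝ → Ω → ℝ}
    (hY : ∀ t, IsStableIntegral α m P M (f t) (Y t)) {c lam δ : ℝ}
    (hinc : ∀ s t, dist s t < δ →
      ∫⁻ x, ENNReal.ofReal (|f s x - f t x| ^ α) ∂m ≤ ENNReal.ofReal (c * dist s t ^ lam)) :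
    HasWeakIncrementBound P Y α lam (2 * 2 ^ α * c).toNNReal δ := by
  intro s t r hst hr
  calc P {ω | r < |Y s ω - Y t ω|}
      ≤ ENNReal.ofReal (2 * (2 / r) ^ α) * ∫⁻ x, ENNReal.ofReal (|f s x - f t x| ^ α) ∂m :=
        ((hY s).sub (hY t) hM (hf s) (hf t)).measure_abs_gt_le hM hα ((hf s).sub (hf t)) hr
    _ ≤ ENNReal.ofReal (2 * (2 / r) ^ α) * ENNReal.ofReal (c * dist s t ^ lam) := by
        gcongr
        exact hinc s t hst
    _ = ENNReal.ofReal (2 * 2 ^ α * c) * ENNReal.ofReal (dist s t ^ lam * r ^ (-α)) := by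
        rw [← ENNReal.ofReal_mul (by positivity), ← ENNReal.ofReal_mul' (by positivity),
          Real.div_rpow zero_le_two hr.le, Real.rpow_neg hr.le]
        ring_nf

theorem proposition2p3_general {E Ω : Type*} [MeasurableSpace E] [MeasurableSpace Ω]
    {P : Measure Ω} [IsProbabilityMeasure P] {α : ℝ} (hα : 0 < α) {m : Measure E}
    {M : Set E → Ω → ℝ} (hM : IsSymStableRandomMeasure α m P M)
    {f : ℝ → E → ℝ} (hf : ∀ t, AEStronglyMeasurable (f t) m)
    {Y : ℝ → Ω → ℝ} (hY : ∀ t, IsStableIntegral α m P M (f t) (Y t))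
    {c lam δ : ℝ} (hlam : 1 < lam) (hδ : 0 < δ)
    (hinc : ∀ s t, dist s t < δ →
      ∫⁻ x, ENNReal.ofReal (|f s x - f t x| ^ α) ∂m ≤ ENNReal.ofReal (c * dist s t ^ lam)) :
    HasHolderModification P Y ((lam - 1) / α) :=
  (hasWeakIncrementBound_of_isStableIntegral hα hM hf hY hinc).hasHolderModification hδ hα hlam
    fun t => (hY t).1

lemma lintegral_comp_sub_left_comp_sub_left {G β : Type*} [AddCommGroup G] [MeasurableSpace G]
    [MeasurableAdd G] (μ : Measure G) [μ.IsAddRightInvariant] (g : G → β) (φ : β → β → ℝ≥0∞)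
    (s t : G) :
    ∫⁻ x, φ (g (s - x)) (g (t - x)) ∂μ = ∫⁻ x, φ (g (s - t - x)) (g (-x)) ∂μ := by
  rw [← lintegral_add_right_eq_self _ t]
  simp only [sub_add_cancel_right, sub_add_eq_sub_sub_swap]

lemma exists_forall_lintegral_sub_rpow_le {g : ℝ → ℝ} {α c lam : ℝ}
    (hinc : ∀ᶠ h : ℝ in 𝓝 0,
      ∫⁻ x : ℝ, ENNReal.ofReal (|g (h - x) - g (-x)| ^ α) ≤ ENNReal.ofReal (c * |h| ^ lam)) :
    ∃ δ > 0, ∀ s t : ℝ, dist s t < δ →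
      ∫⁻ x : ℝ, ENNReal.ofReal (|g (s - x) - g (t - x)| ^ α) ≤
        ENNReal.ofReal (c * dist s t ^ lam) := by
  obtain ⟨δ, hδ, hδinc⟩ := Metric.eventually_nhds_iff.1 hinc
  refine ⟨δ, hδ, fun s t hst => ?_⟩
  rw [lintegral_comp_sub_left_comp_sub_left volume g fun a b => ENNReal.ofReal (|a - b| ^ α)]
  exact hδinc (by rwa [dist_zero_right, Real.norm_eq_abs])

theorem proposition2p3 {Ω : Type*} [MeasurableSpace Ω] (P : Measure Ω) [IsProbabilityMeasure P]
    (α : ℝ) (hα0 : 0 < α) (hα2 : α < 2)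
    (M : Set ℝ → Ω → ℝ) (hM : IsSymStableRandomMeasure α volume P M)
    (g : ℝ → ℝ) (hg : MemLp g (ENNReal.ofReal α) volume)
    (Y : ℝ → Ω → ℝ) (hY : IsStableMovingAverage α P M g Y)
    (c lam : ℝ) (hc : 0 < c) (hlam : 1 < lam)
    (hinc : ∀ᶠ h : ℝ in 𝓝 0,
      ∫⁻ x : ℝ, ENNReal.ofReal (|g (h - x) - g (-x)| ^ α) ≤ ENNReal.ofReal (c * |h| ^ lam)) :
    ∃ Z : ℝ → Ω → ℝ,
      (∀ t, Measurable (Z t)) ∧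
      (∀ t, Z t =ᵐ[P] Y t) ∧
      (∀ ω, Continuous (fun t => Z t ω)) ∧
      (∀ ω, ∀ θ : ℝ≥0, (θ : ℝ) < (lam - 1) / α → ∀ a b : ℝ, ∃ C : ℝ≥0,
        HolderOnWith C θ (fun t => Z t ω) (Set.Icc a b)) := by
  obtain ⟨δ, hδ, hδinc⟩ := exists_forall_lintegral_sub_rpow_le hinc
  exact proposition2p3_general hα0 hM (fun t => hg.1.comp_quasiMeasurePreserving
    (quasiMeasurePreserving_sub_left volume t)) hY hlam hδ hδinc
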